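/- Let $[N]=\{1,\dots,N\}$. For a permutation $A=a_1a_2\cdots a_N$ of $[N]$, an ascent is an index $i$ with $1\le i\le N-1$ and $a_i<a_{i+1}$, and an inversion is a pair $i<j$ with $a_i>a_j$; $A$ is called even or odd according to the parity of its number of inversions. $A$ is a parity-alternate permutation (PAP) if its entries are alternately even and odd, i.e. $a_i\not\equiv a_{i+1}\pmod 2$ for $1\le i\le N-1$. For $N\ge 1$ and $j\ge 0$, let $S_{N,j}$, $P_{N,j}$, $Q_{N,j}$ be the numbers of, respectively, all, even, and odd PAPs of $[N]$ with exactly $j$ ascents, and put $R_{N,j}=P_{N,j}-Q_{N,j}$. Let the signed Eulerian number $D_{N,j}$ be the number of even permutations of $[N]$ with exactly $j$ ascents minus the number of odd permutations of $[N]$ with exactly $j$ ascents (parity-alternate or not). **Theorem 5.2.** Let $p$ be a prime, $m$ a positive integer, $n$ a positive even integer divisible by $p^m$, and $k$ a positive integer divisible by $p$. Then $S_{n-1,k-1}$, $P_{n-1,k-1}$, $Q_{n-1,k-1}$, $R_{n-1,k-1}$ and $D_{n-1,k-1}$ are all divisible by $p^m$. -/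

import Mathlib

namespace ParityAlternate

/-- A permutation `a₁a₂⋯aₙ` of `[n] = {1, …, n}` is an element `π` of `Equiv.Perm (Fin n)`;
positions and values are shifted by one, so that `a_{i+1} = π i + 1` for `i = 0, …, n - 1`. -/
def entry {n : ℕ} (π : Equiv.Perm (Fin n)) (i : Fin n) : ℕ := (π i : ℕ) + 1

/-- The number of ascents: adjacent positions at which the entry increases. -/
def asc {n : ℕ} (π : Equiv.Perm (Fin n)) : ℕ :=
  (Finset.univ.filter fun i : Fin n =>
    ∃ h : (i : ℕ) + 1 < n, entry π i < entry π ⟨(i : ℕ) + 1, h⟩).card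

/-- The number of inversions: pairs of positions `i < j` with `aᵢ > aⱼ`. -/
def inv {n : ℕ} (π : Equiv.Perm (Fin n)) : ℕ :=
  (Finset.univ.filter fun ij : Fin n × Fin n =>
    ij.1 < ij.2 ∧ entry π ij.2 < entry π ij.1).card

/-- Parity-alternate permutations: of any two adjacent entries exactly one is even. -/
def IsPAP {n : ℕ} (π : Equiv.Perm (Fin n)) : Prop :=
  ∀ (i : Fin n) (h : (i : ℕ) + 1 < n),
    (Even (entry π i) ↔ ¬ Even (entry π ⟨(i : ℕ) + 1, h⟩))

instance {n : ℕ} : DecidablePred (IsPAP (n := n)) := fun π => by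
  unfold IsPAP; infer_instance

/-- `E(n,k)`: the permutations of `[n]` with exactly `k` ascents. -/
def E (n k : ℕ) : Finset (Equiv.Perm (Fin n)) :=
  Finset.univ.filter fun π => asc π = k

/-- The permutations in `E(n,k)` with an even number of inversions. -/
def Ee (n k : ℕ) : Finset (Equiv.Perm (Fin n)) :=
  (E n k).filter fun π => Even (inv π)

/-- The permutations in `E(n,k)` with an odd number of inversions. -/
def Eo (n k : ℕ) : Finset (Equiv.Perm (Fin n)) :=
  (E n k).filter fun π => Odd (inv π)

/-- `Ξ(n,k)`: the parity-alternate permutations of `[n]` with exactly `k` ascents. -/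
def Xi (n k : ℕ) : Finset (Equiv.Perm (Fin n)) :=
  (E n k).filter fun π => IsPAP π

/-- The even permutations in `Ξ(n,k)`. -/
def Xie (n k : ℕ) : Finset (Equiv.Perm (Fin n)) := Xi n k ∩ Ee n k

/-- The odd permutations in `Ξ(n,k)`. -/
def Xio (n k : ℕ) : Finset (Equiv.Perm (Fin n)) := Xi n k ∩ Eo n k

/-- `S_{n,k} = |Ξ(n,k)|`. -/
def S (n k : ℕ) : ℕ := (Xi n k).card

/-- `P_{n,k}`: the number of even permutations in `Ξ(n,k)`. -/
def P (n k : ℕ) : ℕ := (Xie n k).card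

/-- `Q_{n,k}`: the number of odd permutations in `Ξ(n,k)`. -/
def Q (n k : ℕ) : ℕ := (Xio n k).card

/-- `R_{n,k} = P_{n,k} - Q_{n,k}`, an integer. -/
def R (n k : ℕ) : ℤ := (P n k : ℤ) - (Q n k : ℤ)

/-- The signed Eulerian number `D_{n,k}`: even minus odd permutations in `E(n,k)`. -/
def D (n k : ℕ) : ℤ := ((Ee n k).card : ℤ) - ((Eo n k).card : ℤ)

end ParityAlternate

namespace ParityAlternate

/-! ### Divisibility from a group action with stabilizers of order prime to `p` -/

/-! Put `N = n - 1`, which is odd. Writing `0` in front of a PAP of `[N]` gives a parity-preserving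
arrangement of `ZMod n` on a circle, with `n - k` cyclic descents when the PAP has `k - 1` ascents.
The group `Fin (N + 1)` acts on these by `shift`, keeping parity, sign and cyclic descents. An
element of order `p` has no fixed point when `p` divides the number of cyclic descents (`shift_ne`),
so stabilizers have order prime to `p` and every orbit size is divisible by `p ^ m`. Sorting by sign
gives `P` and `Q`, hence `S` and `R`. A sign-reversing involution cancels all non-PAPs, so `D = R`.
-/

theorem prime_pow_dvd_card_of_smul_ne {G X : Type*} [Group G] [Fintype G] [Fintype X]
    [MulAction G X] {p m : ℕ} (hp : p.Prime) (hG : p ^ m ∣ Fintype.card G)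
    (hfree : ∀ (g : G) (x : X), orderOf g = p → g • x ≠ x) : p ^ m ∣ Fintype.card X := by
  classical
  have : Fact p.Prime := ⟨hp⟩
  rw [MulAction.card_eq_sum_card_group_div_card_stabilizer G X]
  refine Finset.dvd_sum fun ω _ => ?_
  set x := Quotient.out ω
  -- Cauchy: otherwise the stabilizer would contain an element of order `p`.
  have hcop : ¬ p ∣ Fintype.card (MulAction.stabilizer G x) := by
    intro h
    obtain ⟨g, hg⟩ := exists_prime_orderOf_dvd_card p h
    exact hfree g x (by rw [← hg, Subgroup.orderOf_coe]) g.2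
  have hmul := MulAction.card_orbit_mul_card_stabilizer_eq_card_group G x
  have hpos : 0 < Fintype.card (MulAction.stabilizer G x) := Fintype.card_pos
  rw [← hmul] at hG ⊢
  rw [Nat.mul_div_cancel _ hpos]
  exact Nat.Coprime.dvd_of_dvd_mul_right
    (Nat.Coprime.pow_left m ((Nat.Prime.coprime_iff_not_dvd hp).2 hcop)) hG

/-! ### Circular arrangements -/

open scoped Fin.CommRing

variable {N : ℕ}

/-- The number of cyclic descents of `f`, read around the circle of positions. -/
def cyclicDes (f : Equiv.Perm (Fin (N + 1))) : ℕ :=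
  (Finset.univ.filter fun x => f (x + 1) < f x).card

/-- The increment of `f` from the position `x` to the next, as a number in `{0, …, N}`. -/
def step (f : Equiv.Perm (Fin (N + 1))) (x : Fin (N + 1)) : ℕ := (f (x + 1) - f x : Fin (N + 1))

theorem step_add_eq (f : Equiv.Perm (Fin (N + 1))) (x : Fin (N + 1)) :
    step f x + (f x : ℕ) = f (x + 1) + if f (x + 1) < f x then N + 1 else 0 := by
  unfold step
  split_ifs with h
  · rw [Fin.coe_sub_iff_lt.2 h]
    have := (f x).isLt
    omega
  · rw [Fin.coe_sub_iff_le.2 (not_lt.1 h)]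
    have : (f x : ℕ) ≤ f (x + 1) := not_lt.1 h
    omega

/-- The values telescope around the circle; each descent wraps once and costs `N + 1`. -/
theorem sum_step (f : Equiv.Perm (Fin (N + 1))) :
    ∑ x, step f x = (N + 1) * cyclicDes f := by
  have h := Finset.sum_congr (rfl : (Finset.univ : Finset (Fin (N + 1))) = _)
    fun x _ => step_add_eq f x
  rw [Finset.sum_add_distrib, Finset.sum_add_distrib,
    show ∑ x, (f (x + 1) : ℕ) = ∑ x, (f x : ℕ) from
      Equiv.sum_comp (Equiv.addRight (1 : Fin (N + 1))) fun x => (f x : ℕ),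
    ← Finset.sum_filter, Finset.sum_const, smul_eq_mul] at h
  unfold cyclicDes
  linarith

/-- Add `b` to all values, and rotate the positions so that the value at `0` does not change. -/
def shift (b : Fin (N + 1)) (f : Equiv.Perm (Fin (N + 1))) : Equiv.Perm (Fin (N + 1)) :=
  Equiv.addRight b * f * Equiv.addRight (f.symm (f 0 - b))

theorem shift_apply (b : Fin (N + 1)) (f : Equiv.Perm (Fin (N + 1))) (x : Fin (N + 1)) :
    shift b f x = f (x + f.symm (f 0 - b)) + b := rfl

theorem shift_apply_zero (b : Fin (N + 1)) (f : Equiv.Perm (Fin (N + 1))) :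
    shift b f 0 = f 0 := by
  simp [shift_apply]

theorem shift_zero (f : Equiv.Perm (Fin (N + 1))) : shift 0 f = f := by
  ext x
  simp [shift_apply]

theorem shift_add (a b : Fin (N + 1)) (f : Equiv.Perm (Fin (N + 1))) :
    shift (a + b) f = shift a (shift b f) := by
  -- The two rotations compose because `shift b` leaves the value at `0` unchanged.
  have key : (shift b f).symm (f 0 - a) + f.symm (f 0 - b) = f.symm (f 0 - (a + b)) := by
    rw [Equiv.eq_symm_apply, ← add_left_inj b, ← shift_apply, Equiv.apply_symm_apply]
    abel
  refine Equiv.ext fun x => ?_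
  rw [shift_apply a, shift_apply_zero, shift_apply b, shift_apply, ← key,
    ← add_assoc x, add_comm a b, ← add_assoc]

theorem step_shift (b : Fin (N + 1)) (f : Equiv.Perm (Fin (N + 1))) (x : Fin (N + 1)) :
    step (shift b f) x = step f (x + f.symm (f 0 - b)) := by
  unfold step
  rw [shift_apply, shift_apply, add_sub_add_right_eq_sub, add_right_comm]

/-- Adding `b` may move descents, but it only permutes the steps, whose sum determines their number.
-/
theorem cyclicDes_shift (b : Fin (N + 1)) (f : Equiv.Perm (Fin (N + 1))) :
    cyclicDes (shift b f) = cyclicDes f := by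
  have h : ∑ x, step (shift b f) x = ∑ x, step f x := by
    simp_rw [step_shift]
    exact Equiv.sum_comp (Equiv.addRight (f.symm (f 0 - b))) (step f)
  rw [sum_step, sum_step] at h
  exact Nat.eq_of_mul_eq_mul_left N.succ_pos h

theorem sum_range_mul_of_periodic {g : ℕ → ℕ} {a : ℕ} (hg : Function.Periodic g a) (j : ℕ) :
    ∑ i ∈ Finset.range (j * a), g i = j * ∑ i ∈ Finset.range a, g i := by
  induction j with
  | zero => simp
  | succ j ih =>
    rw [Nat.succ_mul, Finset.sum_range_add, ih, Nat.succ_mul]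
    congr 1
    refine Finset.sum_congr rfl fun i _ => ?_
    rw [add_comm]
    exact hg.nat_mul j i

theorem sum_range_step (f : Equiv.Perm (Fin (N + 1))) (j : ℕ) :
    ((∑ i ∈ Finset.range j, step f i : ℕ) : Fin (N + 1)) = f j - f 0 := by
  induction j with
  | zero => simp
  | succ j ih =>
    rw [Finset.sum_range_succ, Nat.cast_add, ih, step, Fin.cast_val_eq_self, Nat.cast_succ]
    abel

/-- A value shift of order `p` fixes no arrangement with a multiple of `p` cyclic descents. -/
theorem shift_ne {p : ℕ} (hp : 0 < p) {b : Fin (N + 1)} (hpb : p • b = 0)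
    (hb : b ≠ 0) {f : Equiv.Perm (Fin (N + 1))} (hd : p ∣ cyclicDes f) : shift b f ≠ f := by
  intro hf
  set c := f.symm (f 0 - b) with hc
  -- Being fixed means that rotating by `c` lowers all values by `b`, so the steps have period `c`.
  have hfc : ∀ x, f (x + c) = f x - b := fun x => by
    rw [eq_sub_iff_add_eq, hc, ← shift_apply, hf]
  have hfjc : ∀ j : ℕ, f (j • c) = f 0 - j • b := fun j => by
    induction j with
    | zero => simp
    | succ j ih => rw [succ_nsmul, hfc, ih, succ_nsmul]; abel
  have hpc : p • c = 0 := f.injective (by rw [hfjc, hpb, sub_zero])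
  have hper : Function.Periodic (fun i : ℕ => step f i) (c : ℕ) := fun i => by
    change step f _ = step f _
    rw [Nat.cast_add, Fin.cast_val_eq_self]
    unfold step
    rw [add_right_comm, hfc, hfc, sub_sub_sub_cancel_right]
  have hperN : Function.Periodic (fun i : ℕ => step f i) (N + 1) := fun i => by
    change step f _ = step f _
    simp
  have hfull : ∑ i ∈ Finset.range (N + 1), step f i = (N + 1) * cyclicDes f := by
    rw [← sum_step, Finset.sum_range]
    simp
  obtain ⟨s, hs⟩ : N + 1 ∣ p * (c : ℕ) := by
    rw [← Fin.natCast_eq_zero, Nat.cast_mul, Fin.cast_val_eq_self, ← nsmul_eq_mul]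
    exact hpc
  obtain ⟨r, hr⟩ := hd
  -- Sum the steps over `p * c` positions in two ways: `p` periods of length `c`, or `s` full turns.
  -- The factor `p` of `cyclicDes f` then cancels.
  have h1 := sum_range_mul_of_periodic hper p
  rw [hs, mul_comm, sum_range_mul_of_periodic hperN, hfull, hr] at h1
  have h2 : ∑ i ∈ Finset.range (c : ℕ), step f i = (N + 1) * (s * r) := by
    refine Nat.eq_of_mul_eq_mul_left hp ?_
    rw [← h1]
    ring
  -- The first `c` steps sum to `f c - f 0 = -b`, and also to a multiple of `N + 1`.
  have h3 := sum_range_step f (c : ℕ)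
  rw [h2, Nat.cast_mul, Fin.cast_val_eq_self, Fin.natCast_self, zero_mul, hc,
    Equiv.apply_symm_apply] at h3
  apply hb
  rw [sub_sub_cancel_left, eq_comm, neg_eq_zero] at h3
  exact h3

/-! ### Parity and sign under the action -/

theorem sign_addRight (hN : Odd N) (b : Fin (N + 1)) :
    Equiv.Perm.sign (Equiv.addRight b) = (-1) ^ (b : ℕ) := by
  have h : Equiv.addRight b = finRotate (N + 1) ^ (b : ℕ) := by
    have : ∀ j : ℕ, ∀ x : Fin (N + 1), (finRotate (N + 1) ^ j) x = x + j := fun j => by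
      induction j with
      | zero => simp
      | succ j ih =>
        intro x
        rw [pow_succ', Equiv.Perm.mul_apply, ih, finRotate_apply]
        simp [add_assoc]
    ext x
    rw [this]
    simp
  rw [h, map_pow, sign_finRotate, Nat.add_sub_cancel, hN.neg_one_pow]

theorem val_add_mod_two (hN : Odd N) (a b : Fin (N + 1)) :
    ((a + b : Fin (N + 1)) : ℕ) % 2 = (a + b : ℕ) % 2 := by
  rw [Fin.val_add, Nat.mod_mod_of_dvd _ hN.add_one.two_dvd]

/-- The circular arrangements with `0` at position `0`, alternating parity, `d` cyclic descents
and sign `ε`. -/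
def IsAltCircle (d : ℕ) (ε : ℤˣ) (f : Equiv.Perm (Fin (N + 1))) : Prop :=
  f 0 = 0 ∧ (∀ x, (f x : ℕ) % 2 = x % 2) ∧ cyclicDes f = d ∧ Equiv.Perm.sign f = ε

theorem IsAltCircle.shift (hN : Odd N) {d : ℕ} {ε : ℤˣ} {f : Equiv.Perm (Fin (N + 1))}
    (hf : IsAltCircle d ε f) (b : Fin (N + 1)) : IsAltCircle d ε (shift b f) := by
  obtain ⟨h0, hpar, hd, hs⟩ := hf
  -- The rotation takes `0` to the position of `-b`, whose parity is that of `b` since `N + 1` is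
  -- even. Hence parities are kept and the two translation signs cancel.
  have hbc : Even ((b : ℕ) + (f.symm (f 0 - b) : ℕ)) := by
    have h1 := hpar (f.symm (f 0 - b))
    rw [Equiv.apply_symm_apply] at h1
    have h2 := val_add_mod_two hN (f 0 - b) b
    rw [sub_add_cancel, h0, Fin.val_zero] at h2
    rw [h0] at h1 ⊢
    rw [Nat.even_iff]
    omega
  refine ⟨by rw [shift_apply_zero, h0], fun x => ?_, by rw [cyclicDes_shift, hd], ?_⟩
  · rw [shift_apply, val_add_mod_two hN, Nat.add_mod, hpar, ← Nat.add_mod]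
    have := val_add_mod_two hN x (f.symm (f 0 - b))
    rw [Nat.even_iff] at hbc
    omega
  · unfold ParityAlternate.shift
    rw [map_mul, map_mul, sign_addRight hN, sign_addRight hN, hs, mul_right_comm, ← pow_add,
      hbc.neg_one_pow, one_mul]

theorem prime_pow_dvd_card_isAltCircle {p m d : ℕ} (hp : p.Prime) (hN : Odd N)
    (hpn : p ^ m ∣ N + 1) (hd : p ∣ d) (ε : ℤˣ) :
    p ^ m ∣ Nat.card {f : Equiv.Perm (Fin (N + 1)) // IsAltCircle d ε f} := by
  classical
  let _ : MulAction (Multiplicative (Fin (N + 1)))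
      {f : Equiv.Perm (Fin (N + 1)) // IsAltCircle d ε f} :=
    { smul := fun b f => ⟨shift b.toAdd f.1, f.2.shift hN _⟩
      one_smul := fun f => Subtype.ext (shift_zero f.1)
      mul_smul := fun a b f => Subtype.ext (shift_add a.toAdd b.toAdd f.1) }
  rw [Nat.card_eq_fintype_card]
  refine prime_pow_dvd_card_of_smul_ne (G := Multiplicative (Fin (N + 1))) hp (by simpa using hpn)
    fun g f hg h => ?_
  have hpg : p • g.toAdd = 0 := by
    rw [← hg]
    exact pow_orderOf_eq_one g
  refine shift_ne hp.pos hpg (fun h0 => ?_) (f.2.2.2.1.symm ▸ hd) (congrArg Subtype.val h)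
  have : g = 1 := h0
  rw [this, orderOf_one] at hg
  exact hp.one_lt.ne hg

end ParityAlternate
namespace ParityAlternate

/-! ### Signs, parities and ascents of linear arrangements -/

variable {N : ℕ}

theorem sign_eq_neg_one_pow_inv (π : Equiv.Perm (Fin N)) :
    Equiv.Perm.sign π = (-1) ^ inv π := by
  rw [Equiv.Perm.sign_eq_prod_prod_Ioi, inv, ← Finset.prod_const, Finset.prod_filter,
    Fintype.prod_prod_type]
  refine Finset.prod_congr rfl fun i _ => ?_
  rw [show Finset.Ioi i = Finset.univ.filter fun j => i < j by ext; simp, Finset.prod_filter]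
  refine Finset.prod_congr rfl fun j _ => ?_
  by_cases hij : i < j
  · have hne : (π i : ℕ) ≠ π j := fun h => hij.ne (π.injective (Fin.ext h))
    simp only [hij, if_true, true_and, entry, Fin.lt_def]
    split_ifs <;> first | rfl | omega
  · simp [hij]

theorem even_inv_iff (π : Equiv.Perm (Fin N)) : Even (inv π) ↔ Equiv.Perm.sign π = 1 := by
  rw [sign_eq_neg_one_pow_inv]
  constructor
  · exact fun h => h.neg_one_pow
  · intro h
    by_contra hodd
    rw [(Nat.not_even_iff_odd.1 hodd).neg_one_pow] at h
    exact absurd h (by decide)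

theorem odd_inv_iff (π : Equiv.Perm (Fin N)) : Odd (inv π) ↔ Equiv.Perm.sign π = -1 := by
  rw [← Nat.not_even_iff_odd, even_inv_iff]
  rcases Int.units_eq_one_or (Equiv.Perm.sign π) with h | h <;> rw [h] <;> decide

theorem alternates_iff_exists (g : Fin N → ℕ) :
    (∀ (i : Fin N) (h : (i : ℕ) + 1 < N), g i % 2 ≠ g ⟨(i : ℕ) + 1, h⟩ % 2) ↔
      ∃ c : ℕ, ∀ i, (g i + i) % 2 = c % 2 := by
  constructor
  · intro h
    rcases Nat.eq_zero_or_pos N with rfl | hN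
    · exact ⟨0, fun i => i.elim0⟩
    · refine ⟨g ⟨0, hN⟩, ?_⟩
      rintro ⟨i, hi⟩
      induction i with
      | zero => rfl
      | succ i ih =>
        have h1 := ih (by omega)
        have h2 := h ⟨i, by omega⟩ hi
        simp only at h1 h2 ⊢
        omega
  · rintro ⟨c, hc⟩ i h
    have h1 := hc i
    have h2 := hc ⟨(i : ℕ) + 1, h⟩
    simp only at h1 h2
    omega

theorem isPAP_iff_exists (π : Equiv.Perm (Fin N)) :
    IsPAP π ↔ ∃ c : ℕ, ∀ i, ((π i : ℕ) + i) % 2 = c % 2 := by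
  rw [← alternates_iff_exists fun i => (π i : ℕ)]
  refine forall_congr' fun i => forall_congr' fun h => ?_
  simp only [entry, Nat.even_iff]
  omega

/-- Constancy of `π i + i` modulo 2 is symmetric in positions and values. -/
theorem isPAP_iff_symm (π : Equiv.Perm (Fin N)) :
    IsPAP π ↔ ∀ (v : Fin N) (h : (v : ℕ) + 1 < N),
      (π.symm v : ℕ) % 2 ≠ (π.symm ⟨(v : ℕ) + 1, h⟩ : ℕ) % 2 := by
  rw [isPAP_iff_exists, alternates_iff_exists fun v => (π.symm v : ℕ)]
  refine exists_congr fun c => ⟨fun h v => ?_, fun h i => ?_⟩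
  · simpa [add_comm] using h (π.symm v)
  · simpa [add_comm] using h (π i)

theorem isPAP_iff_of_odd (hN : Odd N) (π : Equiv.Perm (Fin N)) :
    IsPAP π ↔ ∀ i, (π i : ℕ) % 2 = i % 2 := by
  rw [isPAP_iff_exists]
  constructor
  · rintro ⟨c, hc⟩
    have hsum : ∑ i, ((π i : ℕ) + i) = 2 * ∑ i : Fin N, (i : ℕ) := by
      rw [Finset.sum_add_distrib, Equiv.sum_comp π fun i => (i : ℕ), two_mul]
    rcases Nat.mod_two_eq_zero_or_one c with h | h
    · intro i
      have := hc i
      omega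
    -- For odd `c` this is a sum of `N` odd terms, yet it is twice the sum of the positions.
    · have hodd : Odd (∑ i, ((π i : ℕ) + i)) := by
        rw [Finset.odd_sum_iff_odd_card_odd, Finset.filter_true_of_mem]
        · simpa using hN
        · intro i _
          rw [Nat.odd_iff, hc, h]
      rw [hsum] at hodd
      exact absurd (even_two_mul _) (Nat.not_even_iff_odd.2 hodd)
  · exact fun h => ⟨0, fun i => by have := h i; omega⟩

/-! ### Closing a linear arrangement to a circular one -/

/-- The circular arrangement obtained by writing `0` in front of `π`. -/
def circle (π : Equiv.Perm (Fin N)) : Equiv.Perm (Fin (N + 1)) :=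
  Equiv.Perm.decomposeFin.symm (0, π)

theorem circle_zero (π : Equiv.Perm (Fin N)) : circle π 0 = 0 := by
  simp [circle]

theorem circle_succ (π : Equiv.Perm (Fin N)) (i : Fin N) : circle π i.succ = (π i).succ := by
  simp [circle]

theorem circle_injective : Function.Injective (circle (N := N)) := fun π σ h => by
  simpa [circle] using h

theorem exists_circle_eq {f : Equiv.Perm (Fin (N + 1))} (hf : f 0 = 0) : ∃ π, circle π = f := by
  obtain ⟨⟨a, π⟩, rfl⟩ := Equiv.Perm.decomposeFin.symm.surjective f
  rw [Equiv.Perm.decomposeFin_symm_apply_zero] at hf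
  exact ⟨π, by rw [hf, circle]⟩

theorem sign_circle (π : Equiv.Perm (Fin N)) :
    Equiv.Perm.sign (circle π) = Equiv.Perm.sign π := by
  simp [circle, Equiv.Perm.decomposeFin.symm_sign]

theorem circle_mod_two_iff (π : Equiv.Perm (Fin N)) :
    (∀ x, (circle π x : ℕ) % 2 = x % 2) ↔ ∀ i, (π i : ℕ) % 2 = i % 2 := by
  rw [Fin.forall_fin_succ]
  simp only [circle_zero, circle_succ, Fin.val_succ, true_and]
  exact forall_congr' fun i => by omega

/-- Leaving `0` is never a descent; returning to it from the last entry is one, matching the last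
index, which `asc` never counts. -/
theorem asc_add_cyclicDes_circle (π : Equiv.Perm (Fin N)) :
    asc π + cyclicDes (circle π) = N := by
  have hdes : cyclicDes (circle π) =
      (Finset.univ.filter fun i : Fin N => circle π (i.succ + 1) < circle π i.succ).card := by
    unfold cyclicDes
    rw [Fin.card_filter_univ_succ, if_neg]
    rw [circle_zero]
    exact Fin.not_lt_zero _
  have hcompl : ∀ i : Fin N, circle π (i.succ + 1) < circle π i.succ ↔
      ¬ ∃ h : (i : ℕ) + 1 < N, entry π i < entry π ⟨(i : ℕ) + 1, h⟩ := fun i => by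
    by_cases h : (i : ℕ) + 1 < N
    · have hi : i.succ + 1 = (⟨(i : ℕ) + 1, h⟩ : Fin N).succ := by
        apply Fin.ext
        rw [Fin.val_add_one_of_lt (by rw [Fin.lt_def]; simpa using h)]
        simp
      have hne : (π i : ℕ) ≠ π ⟨(i : ℕ) + 1, h⟩ := fun hv => by
        have := congrArg Fin.val (π.injective (Fin.ext hv))
        simp at this
      rw [hi, circle_succ, circle_succ, Fin.succ_lt_succ_iff, Fin.lt_def]
      simp only [h, exists_true_left, entry]
      omega
    · have hi : i.succ + 1 = 0 := by
        rw [show i.succ = Fin.last N from Fin.ext (by simp; omega), Fin.last_add_one]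
      rw [hi, circle_zero, circle_succ]
      simp [h]
  rw [hdes, asc, Finset.filter_congr fun i _ => hcompl i,
    Finset.card_filter_add_card_filter_not, Finset.card_univ, Fintype.card_fin]

theorem isAltCircle_circle_iff (hN : Odd N) {j d : ℕ} (hjd : j + d = N) (ε : ℤˣ)
    (π : Equiv.Perm (Fin N)) :
    IsAltCircle d ε (circle π) ↔ (asc π = j ∧ IsPAP π) ∧ Equiv.Perm.sign π = ε := by
  have h := asc_add_cyclicDes_circle π
  rw [IsAltCircle, circle_mod_two_iff, ← isPAP_iff_of_odd hN, sign_circle]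
  have : cyclicDes (circle π) = d ↔ asc π = j := by omega
  rw [this]
  simp only [circle_zero, true_and]
  tauto

theorem card_isAltCircle (hN : Odd N) {j d : ℕ} (hjd : j + d = N) (ε : ℤˣ) :
    Nat.card {f : Equiv.Perm (Fin (N + 1)) // IsAltCircle d ε f} =
      ((Xi N j).filter fun π => Equiv.Perm.sign π = ε).card := by
  rw [← Finset.card_image_of_injective _ circle_injective]
  refine Nat.subtype_card _ fun f => ?_
  simp only [Finset.mem_image, Finset.mem_filter, Xi, E, Finset.mem_univ, true_and]
  constructor
  · rintro ⟨π, h, rfl⟩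
    exact (isAltCircle_circle_iff hN hjd ε π).2 h
  · intro h
    obtain ⟨π, rfl⟩ := exists_circle_eq h.1
    exact ⟨π, (isAltCircle_circle_iff hN hjd ε π).1 h, rfl⟩

end ParityAlternate
namespace ParityAlternate

/-! ### The signed count of all permutations reduces to the parity-alternate ones -/

variable {N : ℕ}

/-- The values `v` and `v + 1` occur in `π` at positions of the same parity. -/
def SameParityAt (π : Equiv.Perm (Fin N)) (v : ℕ) : Prop :=
  ∃ h : v + 1 < N, (π.symm ⟨v, by omega⟩ : ℕ) % 2 = (π.symm ⟨v + 1, h⟩ : ℕ) % 2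

theorem not_isPAP_iff_exists (π : Equiv.Perm (Fin N)) :
    ¬ IsPAP π ↔ ∃ v, SameParityAt π v := by
  rw [isPAP_iff_symm]
  push Not
  exact ⟨fun ⟨v, h, he⟩ => ⟨v, h, he⟩, fun ⟨v, h, he⟩ => ⟨⟨v, by omega⟩, h, he⟩⟩

theorem sameParityAt_iff_of_mod_eq {π σ : Equiv.Perm (Fin N)}
    (h : ∀ v, (σ.symm v : ℕ) % 2 = (π.symm v : ℕ) % 2) (v : ℕ) :
    SameParityAt σ v ↔ SameParityAt π v := by
  simp only [SameParityAt, h]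

/-- Exchange the values `v` and `v + 1`. -/
def swapSucc (π : Equiv.Perm (Fin N)) {v : ℕ} (h : v + 1 < N) : Equiv.Perm (Fin N) :=
  Equiv.swap ⟨v, by omega⟩ ⟨v + 1, h⟩ * π

theorem swapSucc_swapSucc (π : Equiv.Perm (Fin N)) {v w : ℕ} (h : v + 1 < N) (h' : w + 1 < N)
    (hw : w = v) : swapSucc (swapSucc π h) h' = π := by
  subst hw
  exact Equiv.swap_mul_self_mul _ _ _

theorem swapSucc_symm_mod_two (π : Equiv.Perm (Fin N)) {v : ℕ} (h : SameParityAt π v)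
    (w : Fin N) : ((swapSucc π h.1).symm w : ℕ) % 2 = (π.symm w : ℕ) % 2 := by
  obtain ⟨hv, he⟩ := h
  change (π.symm (Equiv.swap _ _ w) : ℕ) % 2 = _
  rw [Equiv.swap_apply_def]
  split_ifs with h1 h2
  · rw [h1, he]
  · rw [h2, he]
  · rfl

theorem swap_lt_swap_iff {v : ℕ} (h : v + 1 < N) {a b : Fin N} (hab : a ≠ b)
    (h1 : ¬ ((a : ℕ) = v ∧ (b : ℕ) = v + 1)) (h2 : ¬ ((b : ℕ) = v ∧ (a : ℕ) = v + 1)) :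
    Equiv.swap (⟨v, by omega⟩ : Fin N) ⟨v + 1, h⟩ a < Equiv.swap ⟨v, by omega⟩ ⟨v + 1, h⟩ b ↔
      a < b := by
  have hab' : (a : ℕ) ≠ b := fun h => hab (Fin.ext h)
  simp only [Equiv.swap_apply_def, Fin.ext_iff, Fin.lt_def]
  split_ifs <;> simp only <;> omega

/-- Only the comparison of `v` with `v + 1` changes, and positions of equal parity are never
adjacent. -/
theorem asc_swapSucc (π : Equiv.Perm (Fin N)) {v : ℕ} (h : SameParityAt π v) :
    asc (swapSucc π h.1) = asc π := by
  obtain ⟨hv, he⟩ := h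
  unfold asc
  congr 1
  refine Finset.filter_congr fun i _ => exists_congr fun hi => ?_
  have hpos : ∀ {w w' : Fin N} {x y : ℕ} (hx : x < N) (hy : y < N),
      (w : ℕ) = x → (w' : ℕ) = y → w = ⟨x, hx⟩ ∧ w' = ⟨y, hy⟩ :=
    fun _ _ h h' => ⟨Fin.ext h, Fin.ext h'⟩
  have key := swap_lt_swap_iff hv (a := π i) (b := π ⟨(i : ℕ) + 1, hi⟩)
    (fun h => by simpa using congrArg Fin.val (π.injective h))
    (fun ⟨h1, h2⟩ => by
      obtain ⟨h1, h2⟩ := hpos (by omega) hv h1 h2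
      rw [← h1, ← h2, Equiv.symm_apply_apply, Equiv.symm_apply_apply] at he
      simp only at he
      omega)
    (fun ⟨h1, h2⟩ => by
      obtain ⟨h1, h2⟩ := hpos (by omega) hv h1 h2
      rw [← h1, ← h2, Equiv.symm_apply_apply, Equiv.symm_apply_apply] at he
      simp only at he
      omega)
  simp only [entry, Nat.add_lt_add_iff_right]
  exact key

theorem sum_sign_not_isPAP (j : ℕ) :
    ∑ π ∈ (E N j).filter (fun π => ¬ IsPAP π), (Equiv.Perm.sign π : ℤ) = 0 := by
  classical
  have hex : ∀ π ∈ (E N j).filter (fun π => ¬ IsPAP π), ∃ v, SameParityAt π v := fun π hπ =>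
    (not_isPAP_iff_exists π).1 (Finset.mem_filter.1 hπ).2
  have hsame : ∀ π hπ w, SameParityAt (swapSucc π (Nat.find_spec (hex π hπ)).1) w ↔
      SameParityAt π w := fun π hπ =>
    sameParityAt_iff_of_mod_eq (swapSucc_symm_mod_two π (Nat.find_spec (hex π hπ)))
  -- Swap at the least admissible `v`. Position parities of all values survive, so the same `v` is
  -- chosen again.
  refine Finset.sum_involution (fun π hπ => swapSucc π (Nat.find_spec (hex π hπ)).1)
    ?_ ?_ ?_ ?_
  · intro π hπ
    rw [swapSucc, map_mul, Equiv.Perm.sign_swap (by simp [Fin.ext_iff])]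
    simp
  · intro π hπ _ h
    have h' := congrArg Equiv.Perm.sign h
    rw [swapSucc, map_mul, Equiv.Perm.sign_swap (by simp [Fin.ext_iff])] at h'
    rcases Int.units_eq_one_or (Equiv.Perm.sign π) with hs | hs <;> rw [hs] at h' <;>
      exact absurd h' (by decide)
  · intro π hπ
    have hv := Nat.find_spec (hex π hπ)
    have hmem := Finset.mem_filter.1 hπ
    simp only [E, Finset.mem_filter, Finset.mem_univ, true_and] at hmem ⊢
    exact ⟨by rw [asc_swapSucc π hv, hmem.1],
      (not_isPAP_iff_exists _).2 ⟨_, (hsame π hπ _).2 hv⟩⟩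
  · intro π hπ
    exact swapSucc_swapSucc π _ _ (Nat.find_congr' (hsame π hπ _))

theorem card_sub_card_eq_sum_sign {s t u : Finset (Equiv.Perm (Fin N))}
    (ht : ∀ π, π ∈ t ↔ π ∈ s ∧ Equiv.Perm.sign π = 1)
    (hu : ∀ π, π ∈ u ↔ π ∈ s ∧ Equiv.Perm.sign π = -1) :
    (t.card : ℤ) - u.card = ∑ π ∈ s, (Equiv.Perm.sign π : ℤ) := by
  have ht' : t = s.filter fun π => Equiv.Perm.sign π = 1 := by ext; simp [ht]
  have hu' : u = s.filter fun π => ¬ Equiv.Perm.sign π = 1 := by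
    ext π
    rcases Int.units_eq_one_or (Equiv.Perm.sign π) with h | h <;> simp [hu, h]
  rw [← Finset.sum_filter_add_sum_filter_not s fun π => Equiv.Perm.sign π = 1, ← ht', ← hu',
    Finset.sum_congr rfl fun π hπ => by rw [((ht π).1 hπ).2],
    Finset.sum_congr (rfl : u = u) fun π hπ => by rw [((hu π).1 hπ).2]]
  simp [sub_eq_add_neg]

/-! ### Assembling the counts -/

theorem mem_Xie (j : ℕ) (π : Equiv.Perm (Fin N)) :
    π ∈ Xie N j ↔ π ∈ Xi N j ∧ Equiv.Perm.sign π = 1 := by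
  simp only [Xie, Xi, Ee, Finset.mem_inter, Finset.mem_filter, even_inv_iff]
  tauto

theorem mem_Xio (j : ℕ) (π : Equiv.Perm (Fin N)) :
    π ∈ Xio N j ↔ π ∈ Xi N j ∧ Equiv.Perm.sign π = -1 := by
  simp only [Xio, Xi, Eo, Finset.mem_inter, Finset.mem_filter, odd_inv_iff]
  tauto

theorem P_eq_card (N j : ℕ) : P N j = ((Xi N j).filter fun π => Equiv.Perm.sign π = 1).card :=
  congrArg Finset.card (Finset.ext fun π => by rw [mem_Xie, Finset.mem_filter])

theorem Q_eq_card (N j : ℕ) : Q N j = ((Xi N j).filter fun π => Equiv.Perm.sign π = -1).card :=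
  congrArg Finset.card (Finset.ext fun π => by rw [mem_Xio, Finset.mem_filter])

theorem D_eq_R (N j : ℕ) : D N j = R N j := by
  rw [D, R, P, Q, card_sub_card_eq_sum_sign (s := E N j) (by simp [Ee, even_inv_iff])
    (by simp [Eo, odd_inv_iff]), card_sub_card_eq_sum_sign (mem_Xie j) (mem_Xio j),
    ← Finset.sum_filter_add_sum_filter_not (E N j) IsPAP, sum_sign_not_isPAP, add_zero, Xi]

theorem S_eq_P_add_Q (N j : ℕ) : S N j = P N j + Q N j := by
  rw [S, P, Q, ← Finset.card_union_of_disjoint]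
  · congr 1
    ext π
    rw [Finset.mem_union, mem_Xie, mem_Xio]
    rcases Int.units_eq_one_or (Equiv.Perm.sign π) with h | h <;> simp [h]
  · rw [Finset.disjoint_left]
    intro π h h'
    rw [mem_Xie] at h
    rw [mem_Xio, h.2] at h'
    exact absurd h'.2 (by decide)

theorem Xi_eq_empty {j : ℕ} (hj : N < j) : Xi N j = ∅ := by
  refine Finset.filter_eq_empty_iff.2 fun π hπ => ?_
  have h1 : asc π = j := (Finset.mem_filter.1 hπ).2
  have h2 : asc π ≤ N := (Finset.card_le_univ _).trans_eq (Fintype.card_fin N)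
  omega

theorem prime_pow_dvd_card_Xi_filter_sign {p m j : ℕ} (hp : p.Prime) (hm : 0 < m) (hN : Odd N)
    (hpn : p ^ m ∣ N + 1) (hpj : p ∣ j + 1) (ε : ℤˣ) :
    p ^ m ∣ ((Xi N j).filter fun π => Equiv.Perm.sign π = ε).card := by
  -- For `j > N` the truncated `N - j` would not be the number of cyclic descents; otherwise it is
  -- `(N + 1) - (j + 1)`, a multiple of `p`.
  rcases lt_or_ge N j with hj | hj
  · simp [Xi_eq_empty hj]
  · rw [← card_isAltCircle hN (Nat.add_sub_of_le hj) ε]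
    refine prime_pow_dvd_card_isAltCircle hp hN hpn ?_ ε
    rw [← Nat.add_sub_add_right N 1 j]
    exact Nat.dvd_sub ((dvd_pow_self p hm.ne').trans hpn) hpj

end ParityAlternate

theorem theorem5p2 (p m n k : ℕ) (hp : p.Prime) (hm : 0 < m) (hn : 0 < n) (hn2 : Even n)
    (hpn : p ^ m ∣ n) (hk : 0 < k) (hpk : p ∣ k) :
    p ^ m ∣ ParityAlternate.S (n - 1) (k - 1) ∧
    p ^ m ∣ ParityAlternate.P (n - 1) (k - 1) ∧
    p ^ m ∣ ParityAlternate.Q (n - 1) (k - 1) ∧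
    (p : ℤ) ^ m ∣ ParityAlternate.R (n - 1) (k - 1) ∧
    (p : ℤ) ^ m ∣ ParityAlternate.D (n - 1) (k - 1) := by
  have hsign := ParityAlternate.prime_pow_dvd_card_Xi_filter_sign hp hm
    (Nat.Even.sub_odd hn hn2 odd_one) (by rwa [Nat.sub_add_cancel hn])
    (j := k - 1) (by rwa [Nat.sub_add_cancel hk])
  have hP : p ^ m ∣ ParityAlternate.P (n - 1) (k - 1) := by
    rw [ParityAlternate.P_eq_card]
    exact hsign 1
  have hQ : p ^ m ∣ ParityAlternate.Q (n - 1) (k - 1) := by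
    rw [ParityAlternate.Q_eq_card]
    exact hsign (-1)
  have hR : (p : ℤ) ^ m ∣ ParityAlternate.R (n - 1) (k - 1) :=
    dvd_sub (by exact_mod_cast hP) (by exact_mod_cast hQ)
  refine ⟨?_, hP, hQ, hR, ?_⟩
  · rw [ParityAlternate.S_eq_P_add_Q]
    exact dvd_add hP hQ
  · rwa [ParityAlternate.D_eq_R]
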